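/- Let $r$ be a natural number with $\gcd(r,360)=1$ (for instance, a residue $0<r<360$ coprime to $360$). For real $x$ let $\pi(x,r,360)$ denote the number of primes $p\le x$ with $p\equiv r \pmod{360}$; for $0<r<360$ these are the primes $p \le x$ in the arithmetic progression $r+360n$, $n=0,1,2,\dots$. Then $$\lim_{x\to\infty}\frac{\pi(x,r,360)\,\varphi(360)}{x/\log x}=1,$$ where $x$ tends to infinity through the real numbers, $\log$ is the natural logarithm and $\varphi$ is Euler's totient function. -/

import Mathlib

/-- `primeCountingAP x r q` is `π(x, r, q)`: the number of primes `p ≤ x` that are congruent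
to `r` modulo `q`, for a real number `x`. -/
noncomputable def primeCountingAP (x : ℝ) (r q : ℕ) : ℕ :=
  ((Finset.range (⌊x⌋₊ + 1)).filter (fun p : ℕ => p.Prime ∧ p ≡ r [MOD q])).card

/-!
The primes in a residue class are counted through the von Mangoldt function `Λ`, by a Tauberian
argument of Wiener–Ikehara type that holds for every modulus `q`.

Let `ψ_a(x)` be the sum of `Λ n` over `n ≤ x` with `n ≡ a` modulo `q`, and put
`B u = ψ_a(e ^ u) * e ^ (-u)`, which is bounded by Chebyshev's estimate. By Abel summation, the
Laplace transform of `B` at `s` is `L(1 + s) / (1 + s)`, where `L` is the `L`-series of `Λ`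
restricted to the class. Mathlib's non-vanishing of Dirichlet `L`-functions on `re s = 1` shows
that `L(s) - c / (s - 1)`, with `c = 1 / φ(q)`, extends continuously to `re s ≥ 1`; hence the
Laplace transform of `B - c` extends continuously to `re s ≥ 0`.

The Tauberian step (`tendsto_of_continuousOn_laplace`) concludes that `B u → c`. The Fejér kernel
is nonnegative, integrable, and the Fourier transform of the triangle function, which has compact
support. So the averages of `B - c` against translates of the rescaled kernel are Fourier integrals
of the boundary values of the Laplace transform over a compact segment, and tend to zero by the
Riemann–Lebesgue lemma (`tendsto_integral_mul_fejerKernel`). As `B u * e ^ u` is monotone,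
concentrating the kernel just to the right and just to the left of a point `x` bounds `B x` from
above and from below (`tendsto_of_tendsto_integral_mul_fejerKernel`).

Higher prime powers contribute `O(√x log x)` to `ψ_a(x)`, so the sum of `log p` over the primes in
the class is asymptotic to `c * x` too (`tendsto_thetaAP_div`). Nearly all of these primes `p`
exceed `x ^ α` for a given `α < 1`, so that `log p` can be replaced by `log x`
(`tendsto_primeCountingAP`).
-/

section PrimesInArithmeticProgressions

open Complex MeasureTheory Filter Topology Set
open ArithmeticFunction.vonMangoldt (residueClass residueClass_nonneg residueClass_le
  LFunctionResidueClassAux)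

/-! ### The Fejér kernel -/

/-- The Fejér kernel `u ↦ (sin (u / 2) / (u / 2)) ^ 2`, with value `1` at `0`. -/
noncomputable def fejerKernel (u : ℝ) : ℝ := Real.sinc (u / 2) ^ 2

lemma fejerKernel_nonneg (u : ℝ) : 0 ≤ fejerKernel u := sq_nonneg _

lemma continuous_fejerKernel : Continuous fejerKernel := by
  unfold fejerKernel
  exact (Real.continuous_sinc.comp (by fun_prop)).pow 2

lemma fejerKernel_le (u : ℝ) : fejerKernel u ≤ 5 * (1 + u ^ 2)⁻¹ := by
  rw [← div_eq_mul_inv, le_div_iff₀ (by positivity)]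
  have h1 : fejerKernel u ≤ 1 := by
    unfold fejerKernel
    exact (sq_le_one_iff_abs_le_one _).2 (Real.abs_sinc_le_one _)
  have h2 : fejerKernel u * u ^ 2 ≤ 4 := by
    rcases eq_or_ne u 0 with rfl | hu
    · simp
    · have : fejerKernel u * u ^ 2 = 4 * Real.sin (u / 2) ^ 2 := by
        unfold fejerKernel
        rw [Real.sinc_of_ne_zero (by positivity)]
        field_simp
        ring
      rw [this]
      nlinarith [Real.sin_sq_le_one (u / 2)]
  nlinarith

lemma integrable_fejerKernel : Integrable fejerKernel := by
  refine (integrable_inv_one_add_sq.const_mul 5).mono'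
    continuous_fejerKernel.aestronglyMeasurable (ae_of_all _ fun u ↦ ?_)
  rw [Real.norm_of_nonneg (fejerKernel_nonneg u)]
  exact fejerKernel_le u

lemma integral_fejerKernel_pos : 0 < ∫ u, fejerKernel u :=
  integral_pos_of_integrable_nonneg_nonzero (x := 0) continuous_fejerKernel
    integrable_fejerKernel fejerKernel_nonneg (by simp [fejerKernel])

lemma integral_one_sub_mul_cexp {w : ℂ} (hw : w ≠ 0) :
    ∫ t in (0 : ℝ)..1, (1 - t : ℂ) * cexp (w * t) = (cexp w - 1 - w) / w ^ 2 := by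
  have h (t : ℝ) : HasDerivAt
      (fun t : ℝ ↦ (1 - t : ℂ) * (cexp (w * t) / w) + cexp (w * t) / w ^ 2)
      ((1 - t : ℂ) * cexp (w * t)) t := by
    have h0 : HasDerivAt (fun t : ℝ ↦ (t : ℂ)) 1 t := hasDerivAt_id t |>.ofReal_comp
    have h1 : HasDerivAt (fun t : ℝ ↦ cexp (w * t)) (cexp (w * t) * (w * 1)) t :=
      (h0.const_mul w).cexp
    convert! ((h0.const_sub 1).mul (h1.div_const w)).add (h1.div_const (w ^ 2)) using 1
    field_simp
    ring
  rw [intervalIntegral.integral_eq_sub_of_hasDerivAt (fun t _ ↦ h t)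
    (Continuous.intervalIntegrable (by fun_prop) _ _)]
  simp
  field_simp
  ring

/-- The Fejér kernel is the Fourier transform of the triangle function `1 - |t|` on `[-1, 1]`. -/
lemma integral_one_sub_abs_mul_cexp (u : ℝ) :
    ∫ t in (-1 : ℝ)..1, ((1 - |t| : ℝ) : ℂ) * cexp (t * u * I) = fejerKernel u := by
  have hc : Continuous fun t : ℝ ↦ ((1 - |t| : ℝ) : ℂ) * cexp (t * u * I) := by fun_prop
  rw [← intervalIntegral.integral_add_adjacent_intervals (b := 0)
    (hc.intervalIntegrable _ _) (hc.intervalIntegrable _ _)]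
  have e1 : ∫ t in (-1 : ℝ)..0, ((1 - |t| : ℝ) : ℂ) * cexp (t * u * I) =
      ∫ t in (0 : ℝ)..1, (1 - t : ℂ) * cexp ((-u * I) * t) := by
    have := intervalIntegral.integral_comp_neg (a := 0) (b := 1)
      (fun t : ℝ ↦ ((1 - |t| : ℝ) : ℂ) * cexp (t * u * I))
    rw [neg_zero] at this
    rw [← this]
    refine intervalIntegral.integral_congr fun t ht ↦ ?_
    rw [uIcc_of_le zero_le_one] at ht
    simp only [abs_neg, abs_of_nonneg ht.1]
    push_cast
    congr 2
    ring
  have e2 : ∫ t in (0 : ℝ)..1, ((1 - |t| : ℝ) : ℂ) * cexp (t * u * I) =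
      ∫ t in (0 : ℝ)..1, (1 - t : ℂ) * cexp ((u * I) * t) := by
    refine intervalIntegral.integral_congr fun t ht ↦ ?_
    rw [uIcc_of_le zero_le_one] at ht
    simp only [abs_of_nonneg ht.1]
    push_cast
    congr 2
    ring
  rw [e1, e2]
  rcases eq_or_ne u 0 with rfl | hu
  · have : ∫ t in (0 : ℝ)..1, (1 - t : ℂ) = 1 / 2 := by
      have := integral_id (a := (0 : ℝ)) (b := 1)
      have h2 : ∫ t in (0 : ℝ)..1, (1 - t : ℂ) = ((∫ t in (0 : ℝ)..1, (1 - t : ℝ) : ℝ) : ℂ) := by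
        rw [← intervalIntegral.integral_ofReal]
        push_cast
        rfl
      rw [h2, intervalIntegral.integral_sub (by simp) (by simp), this]
      simp
      norm_num
    simp [this, fejerKernel]
    norm_num
  · have hu' : (u : ℂ) ≠ 0 := by exact_mod_cast hu
    rw [integral_one_sub_mul_cexp (mul_ne_zero (neg_ne_zero.2 hu') I_ne_zero),
      integral_one_sub_mul_cexp (mul_ne_zero hu' I_ne_zero)]
    have hk : fejerKernel u = 2 * (1 - Real.cos u) / u ^ 2 := by
      unfold fejerKernel
      rw [Real.sinc_of_ne_zero (by positivity), div_pow, Real.sin_sq_eq_half_sub]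
      field_simp
    have hcos : cexp (u * I) + cexp (-(u * I)) = 2 * Complex.cos u := by
      rw [Complex.cos, neg_mul]; ring
    rw [hk]
    push_cast
    rw [mul_pow, mul_pow, I_sq, neg_sq]
    field_simp
    linear_combination -hcos

/-! ### Averages of functions with continuous Laplace transform -/

/-- Writing the Fejér kernel as the Fourier transform of the triangle function and exchanging the
integrals expresses the damped average of `H` by the Laplace transform of `H` on a vertical
segment. -/
lemma integral_exp_mul_fejerKernel {H : ℝ → ℝ} (hm : Measurable H) {M : ℝ} (hM : ∀ u, |H u| ≤ M)
    {ε : ℝ} (hε : 0 < ε) (l y : ℝ) :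
    ∫ u in Ioi (0 : ℝ), (H u * cexp (-ε * u)) * fejerKernel (l * (u - y)) =
      ∫ t in (-1 : ℝ)..1, ((1 - |t| : ℝ) : ℂ) * cexp (-(t * l * y) * I) *
        ∫ u in Ioi (0 : ℝ), H u * cexp (-(ε - l * t * I) * u) := by
  simp_rw [← integral_one_sub_abs_mul_cexp, ← integral_const_mul,
    ← intervalIntegral.integral_const_mul]
  rw [intervalIntegral.integral_of_le (by norm_num)]
  simp_rw [intervalIntegral.integral_of_le (show (-1 : ℝ) ≤ 1 by norm_num)]
  rw [integral_integral_swap]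
  · refine integral_congr_ae (ae_of_all _ fun t ↦ integral_congr_ae (ae_of_all _ fun u ↦ ?_))
    have : cexp (-ε * u) * cexp (t * ↑(l * (u - y)) * I) =
        cexp (-(t * l * y) * I) * cexp (-(ε - l * t * I) * u) := by
      rw [← Complex.exp_add, ← Complex.exp_add]
      congr 1
      push_cast
      ring
    dsimp only
    linear_combination ((1 - |t| : ℝ) : ℂ) * H u * this
  · have h1 : Integrable (fun u : ℝ ↦ (H u : ℂ) * cexp (-ε * u)) (volume.restrict (Ioi 0)) := by
      refine Integrable.bdd_mul (c := M) ?_ ?_ (ae_of_all _ fun u ↦ ?_)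
      · have := (integrableOn_exp_mul_Ioi (neg_neg_iff_pos.2 hε) 0).ofReal (𝕜 := ℂ)
        simpa using! this
      · exact (measurable_ofReal.comp hm).aestronglyMeasurable
      · simpa using hM u
    have h2 : Integrable (fun t : ℝ ↦ ((1 - |t| : ℝ) : ℂ)) (volume.restrict (Ioc (-1) 1)) :=
      ((by fun_prop : Continuous fun t : ℝ ↦ ((1 - |t| : ℝ) : ℂ)).continuousOn.integrableOn_compact
        isCompact_Icc).mono_set Ioc_subset_Icc_self
    have h3 := (h1.mul_prod h2).mul_bdd (c := 1)
      (g := fun z : ℝ × ℝ ↦ cexp (z.2 * ↑(l * (z.1 - y)) * I))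
      (by fun_prop : Continuous _).aestronglyMeasurable (ae_of_all _ fun z ↦ by
        rw [← ofReal_mul, norm_exp_ofReal_mul_I])
    refine h3.congr (ae_of_all _ fun z ↦ ?_)
    simp only [Function.uncurry]
    ring

/-- If the Laplace transform of a bounded function `H` on `(0, ∞)` has a continuous extension `g`
to the closed half-plane, then the integral of `H` against a translated Fejér kernel is a
Fourier integral of the boundary values of `g` over a compact interval. -/
lemma integral_mul_fejerKernel_eq {H : ℝ → ℝ} (hm : Measurable H) {M : ℝ} (hM : ∀ u, |H u| ≤ M)
    {g : ℂ → ℂ} (hg : ContinuousOn g {s | 0 ≤ s.re})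
    (hL : ∀ s : ℂ, 0 < s.re → ∫ u in Ioi (0 : ℝ), H u * cexp (-s * u) = g s)
    {l : ℝ} (hl : 0 < l) (y : ℝ) :
    ∫ u in Ioi (0 : ℝ), (H u : ℂ) * fejerKernel (l * (u - y)) =
      ∫ t in (-1 : ℝ)..1, ((1 - |t| : ℝ) : ℂ) * cexp (-(t * l * y) * I) * g (-(l * t * I)) := by
  have hM0 : 0 ≤ M := (abs_nonneg _).trans (hM 0)
  have hK : Integrable fun u ↦ fejerKernel (l * (u - y)) :=
    (integrable_fejerKernel.comp_mul_left' hl.ne').comp_sub_right y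
  -- Both sides of `integral_exp_mul_fejerKernel` converge as `ε` tends to `0` from the right; on
  -- the left, integrability of the kernel and boundedness of `H` dominate.
  have t1 : Tendsto (fun ε : ℝ ↦ ∫ u in Ioi (0 : ℝ),
      (H u * cexp (-ε * u)) * fejerKernel (l * (u - y))) (𝓝[>] 0)
      (𝓝 (∫ u in Ioi (0 : ℝ), (H u : ℂ) * fejerKernel (l * (u - y)))) := by
    refine tendsto_integral_filter_of_dominated_convergence
      (fun u ↦ M * fejerKernel (l * (u - y))) (.of_forall fun ε ↦ ?_) ?_
      (hK.integrableOn.const_mul M) (ae_of_all _ fun u ↦ ?_)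
    · have h1 : Measurable fun u : ℝ ↦ (fejerKernel (l * (u - y)) : ℂ) := by
        have := continuous_fejerKernel
        exact (by fun_prop : Continuous _).measurable
      exact (((measurable_ofReal.comp hm).mul (by fun_prop)).mul h1).aestronglyMeasurable
    · filter_upwards [self_mem_nhdsWithin] with ε hε
      filter_upwards [ae_restrict_mem measurableSet_Ioi] with u hu
      rw [norm_mul, norm_mul, norm_real, norm_real, Real.norm_of_nonneg (fejerKernel_nonneg _),
        Complex.norm_exp]
      refine mul_le_mul_of_nonneg_right ?_ (fejerKernel_nonneg _)
      have hε' : (0 : ℝ) < ε := hε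
      have hu' : (0 : ℝ) < u := hu
      have : (-(ε : ℂ) * u).re ≤ 0 := by
        simp only [neg_mul, neg_re, mul_re, ofReal_re, ofReal_im, mul_zero, sub_zero]
        nlinarith
      calc ‖H u‖ * Real.exp _ ≤ M * 1 :=
            mul_le_mul (hM u) (Real.exp_le_one_iff.2 this) (Real.exp_pos _).le hM0
        _ = M := mul_one M
    · have : Continuous fun ε : ℝ ↦ (H u * cexp (-ε * u)) * fejerKernel (l * (u - y)) := by
        fun_prop
      simpa using (this.tendsto 0).mono_left nhdsWithin_le_nhds
  have t2 : Tendsto (fun ε : ℝ ↦ ∫ t in (-1 : ℝ)..1,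
      ((1 - |t| : ℝ) : ℂ) * cexp (-(t * l * y) * I) * g (ε - l * t * I)) (𝓝[>] 0)
      (𝓝 (∫ t in (-1 : ℝ)..1,
        ((1 - |t| : ℝ) : ℂ) * cexp (-(t * l * y) * I) * g (-(l * t * I)))) := by
    have hG : ContinuousOn (fun p : ℝ × ℝ ↦ ((1 - |p.2| : ℝ) : ℂ) * cexp (-(p.2 * l * y) * I) *
        g (p.1 - l * p.2 * I)) (Ici 0 ×ˢ univ) := by
      refine ContinuousOn.mul (by fun_prop) (hg.comp (by fun_prop) ?_)
      rintro ⟨ε, t⟩ ⟨h, -⟩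
      simpa using h
    have hcomp : IsCompact (Icc (0 : ℝ) 1 ×ˢ Icc (-1 : ℝ) 1) := isCompact_Icc.prod isCompact_Icc
    obtain ⟨C, hC⟩ := hcomp.exists_bound_of_continuousOn
      (hG.mono (prod_mono Icc_subset_Ici_self (subset_univ _)))
    refine intervalIntegral.tendsto_integral_filter_of_dominated_convergence (fun _ ↦ C)
      ?_ ?_ (by simp) (ae_of_all _ fun t _ ↦ ?_)
    · filter_upwards [self_mem_nhdsWithin] with ε hε
      have : ContinuousOn (fun t : ℝ ↦ ((1 - |t| : ℝ) : ℂ) * cexp (-(t * l * y) * I) *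
          g (ε - l * t * I)) univ :=
        hG.comp (f := fun t : ℝ ↦ (ε, t)) (by fun_prop)
          fun t _ ↦ ⟨mem_Ici.2 (le_of_lt hε), mem_univ _⟩
      exact (continuousOn_univ.1 this).aestronglyMeasurable
    · filter_upwards [Ioc_mem_nhdsGT zero_lt_one] with ε hε
      refine ae_of_all _ fun t ht ↦ hC (ε, t) ⟨⟨hε.1.le, hε.2⟩, ?_⟩
      rw [uIoc_of_le (by norm_num)] at ht
      exact ⟨ht.1.le, ht.2⟩
    · have h1 := (hG (0, t) ⟨self_mem_Ici, mem_univ _⟩).tendsto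
      have h2 : Tendsto (fun ε : ℝ ↦ (ε, t)) (𝓝[>] 0) (𝓝[Ici 0 ×ˢ univ] (0, t)) := by
        refine tendsto_nhdsWithin_iff.2 ⟨?_, ?_⟩
        · exact ((by fun_prop : Continuous fun ε : ℝ ↦ (ε, t)).tendsto 0).mono_left
            nhdsWithin_le_nhds
        · filter_upwards [self_mem_nhdsWithin] with ε hε
          exact ⟨mem_Ici.2 (le_of_lt hε), mem_univ _⟩
      simpa [Function.comp_def] using h1.comp h2
  refine tendsto_nhds_unique t1 (t2.congr' ?_)
  filter_upwards [self_mem_nhdsWithin] with ε hε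
  rw [integral_exp_mul_fejerKernel hm hM hε]
  refine intervalIntegral.integral_congr fun t _ ↦ ?_
  rw [hL _ (by simpa using hε)]

/-- The Riemann–Lebesgue lemma makes the averages of `H` against a translated Fejér kernel
tend to zero. -/
lemma tendsto_integral_mul_fejerKernel {H : ℝ → ℝ} (hm : Measurable H) {M : ℝ}
    (hM : ∀ u, |H u| ≤ M) {g : ℂ → ℂ} (hg : ContinuousOn g {s | 0 ≤ s.re})
    (hL : ∀ s : ℂ, 0 < s.re → ∫ u in Ioi (0 : ℝ), H u * cexp (-s * u) = g s)
    {l : ℝ} (hl : 0 < l) :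
    Tendsto (fun y : ℝ ↦ ∫ u in Ioi (0 : ℝ), H u * fejerKernel (l * (u - y))) atTop (𝓝 0) := by
  have hRL := (Real.tendsto_integral_exp_smul_cocompact
    ((Ioc (-1 : ℝ) 1).indicator fun t ↦ ((1 - |t| : ℝ) : ℂ) * g (-(l * t * I)))).mono_left
    atTop_le_cocompact
  have hsc : Tendsto (fun y : ℝ ↦ l / (2 * Real.pi) * y) atTop atTop :=
    tendsto_id.const_mul_atTop (by positivity)
  have h := hRL.comp hsc
  rw [← tendsto_ofReal_iff, ofReal_zero]
  refine h.congr fun y ↦ ?_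
  rw [← integral_complex_ofReal]
  simp_rw [ofReal_mul]
  rw [integral_mul_fejerKernel_eq hm hM hg hL hl, intervalIntegral.integral_of_le (by norm_num),
    ← integral_indicator measurableSet_Ioc, Function.comp_apply]
  refine integral_congr_ae (ae_of_all _ fun t ↦ ?_)
  simp only [indicator]
  split_ifs
  · rw [Circle.smul_def, Real.fourierChar_apply, smul_eq_mul]
    have : ((2 * Real.pi * -(t * (l / (2 * Real.pi) * y)) : ℝ) : ℂ) = -(t * l * y) := by
      have : (Real.pi : ℂ) ≠ 0 := by exact_mod_cast Real.pi_ne_zero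
      push_cast
      field_simp
    rw [this]
    ring
  · simp

/-! ### The Tauberian theorem -/

lemma measurable_of_monotone_mul_exp {B : ℝ → ℝ} (hmono : Monotone fun u ↦ B u * Real.exp u) :
    Measurable B := by
  have : B = fun u ↦ B u * Real.exp u * Real.exp (-u) := by
    ext u
    rw [mul_assoc, ← Real.exp_add]
    simp
  rw [this]
  exact hmono.measurable.mul (by fun_prop)

/-- If the averages of `B - c` against translates of every rescaled Fejér kernel tend to zero, then
`B` tends to `c`, provided that `B` is bounded and slowly decreasing. Since `B u * exp u` is
monotone, `B` is almost at least `B x` just to the right of `x` and almost at most `B x` just to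
the left of it, so a kernel concentrated there compares `B x` with the average. -/
lemma tendsto_of_tendsto_integral_mul_fejerKernel {B : ℝ → ℝ} {c M : ℝ}
    (hmono : Monotone fun u ↦ B u * Real.exp u) (h0 : ∀ u, 0 ≤ B u) (hM : ∀ u, B u ≤ M)
    (hc : 0 ≤ c)
    (hJ : ∀ l > 0, Tendsto (fun y : ℝ ↦ ∫ u in Ioi (0 : ℝ), (B u - c) * fejerKernel (l * (u - y)))
      atTop (𝓝 0)) :
    Tendsto B atTop (𝓝 c) := by
  have hBm := measurable_of_monotone_mul_exp hmono
  have hM0 : 0 ≤ M := (h0 0).trans (hM 0)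
  set T : ℝ := ∫ u, fejerKernel u with hT
  have hTpos : 0 < T := integral_fejerKernel_pos
  have main (δ : ℝ) (hδ : 0 < δ) : ∀ᶠ x in atTop,
      B x * Real.exp (-(2 * δ)) * (1 - δ) ≤ c + δ ∧
        c * (1 - δ) - δ - M * δ ≤ B x * Real.exp (2 * δ) := by
    -- `l` is chosen so that the kernel has all but a fraction `δ` of its mass within `δ` of
    -- its centre.
    obtain ⟨R, hR, hRpos⟩ : ∃ R, T * (1 - δ) < (∫ v in -R..R, fejerKernel v) ∧ 0 < R :=
      (((intervalIntegral_tendsto_integral integrable_fejerKernel tendsto_neg_atTop_atBot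
        tendsto_id).eventually (lt_mem_nhds (by nlinarith : T * (1 - δ) < T))).and
        (eventually_gt_atTop 0)).exists
    set l : ℝ := R / δ with hl
    have hlpos : 0 < l := by positivity
    have hlδ : l * δ = R := by rw [hl]; field_simp
    -- Mass of the kernel centred at `y`: in total, and within distance `δ` of `y`.
    have hKi (y : ℝ) : Integrable fun u ↦ fejerKernel (l * (u - y)) :=
      (integrable_fejerKernel.comp_mul_left' hlpos.ne').comp_sub_right y
    have hKn (y u : ℝ) : 0 ≤ fejerKernel (l * (u - y)) := fejerKernel_nonneg _
    have htot (y : ℝ) : l * ∫ u, fejerKernel (l * (u - y)) = T := by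
      rw [integral_sub_right_eq_self (fun u ↦ fejerKernel (l * u)) y,
        Measure.integral_comp_mul_left, abs_of_pos (by positivity), smul_eq_mul, hT]
      field_simp
    have hnear (y : ℝ) : T * (1 - δ) ≤ l * ∫ u in Ioc (y - δ) (y + δ),
        fejerKernel (l * (u - y)) := by
      rw [← intervalIntegral.integral_of_le (by linarith)]
      have h := intervalIntegral.smul_integral_comp_mul_sub (a := y - δ) (b := y + δ)
        fejerKernel l (l * y)
      rw [smul_eq_mul, show l * (y - δ) - l * y = -R by rw [← hlδ]; ring,
        show l * (y + δ) - l * y = R by rw [← hlδ]; ring] at h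
      simp_rw [mul_sub l]
      rw [h]
      exact hR.le
    have hBK (y : ℝ) : Integrable fun u ↦ B u * fejerKernel (l * (u - y)) :=
      (hKi y).bdd_mul (c := M) hBm.aestronglyMeasurable
        (ae_of_all _ fun u ↦ by rw [Real.norm_of_nonneg (h0 u)]; exact hM u)
    have hsplit (y : ℝ) : ∫ u in Ioi (0 : ℝ), (B u - c) * fejerKernel (l * (u - y)) =
        (∫ u in Ioi (0 : ℝ), B u * fejerKernel (l * (u - y))) -
          c * ∫ u in Ioi (0 : ℝ), fejerKernel (l * (u - y)) := by
      rw [← integral_const_mul, ← integral_sub (hBK y).integrableOn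
        ((hKi y).const_mul c).integrableOn]
      simp_rw [sub_mul]
    -- The averages of `B - c`, small compared with the total mass `T / l` of the kernel.
    have hsmall : ∀ᶠ y in atTop,
        |∫ u in Ioi (0 : ℝ), (B u - c) * fejerKernel (l * (u - y))| < δ * T / l := by
      have := (hJ l hlpos).abs
      rw [abs_zero] at this
      exact this.eventually (gt_mem_nhds (by positivity))
    have hexp {u v : ℝ} (h : u ≤ v) : B u * Real.exp (u - v) ≤ B v := by
      have := hmono h
      simp only at this
      rw [Real.exp_sub, ← mul_div_assoc, div_le_iff₀ (Real.exp_pos v)]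
      exact this
    have hsmall' (y : ℝ) : |∫ u in Ioi (0 : ℝ), (B u - c) * fejerKernel (l * (u - y))| <
        δ * T / l → l * |∫ u in Ioi (0 : ℝ), (B u - c) * fejerKernel (l * (u - y))| < δ * T := by
      intro hy
      rwa [lt_div_iff₀' hlpos] at hy
    filter_upwards [(tendsto_atTop_add_const_right atTop δ tendsto_id).eventually hsmall,
      (tendsto_atTop_add_const_right atTop (-δ) tendsto_id).eventually hsmall,
      eventually_gt_atTop (2 * δ)] with x hx1 hx2 hx
    simp only [id, ← sub_eq_add_neg] at hx1 hx2
    constructor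
    -- Upper bound: on `(x, x + 2 * δ]`, which carries most of the mass of the kernel centred at
    -- `x + δ`, the function `B` is at least `B x * exp (-(2 * δ))`.
    · have hsub : Ioc (x + δ - δ) (x + δ + δ) ⊆ Ioi 0 := fun u hu ↦ by
        have := hu.1
        simp only [mem_Ioi]
        linarith
      have e1 : B x * Real.exp (-(2 * δ)) * ∫ u in Ioc (x + δ - δ) (x + δ + δ),
          fejerKernel (l * (u - (x + δ))) ≤
          ∫ u in Ioi (0 : ℝ), B u * fejerKernel (l * (u - (x + δ))) := by
        rw [← integral_const_mul]
        refine (setIntegral_mono_on ((hKi _).const_mul _).integrableOn (hBK (x + δ)).integrableOn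
          measurableSet_Ioc fun u hu ↦ ?_).trans
          (setIntegral_mono_set (hBK _).integrableOn
            (ae_of_all _ fun u ↦ mul_nonneg (h0 u) (hKn _ u)) hsub.eventuallyLE)
        refine mul_le_mul_of_nonneg_right ?_ (hKn _ _)
        refine le_trans ?_ (hexp (u := x) (v := u) (by linarith [hu.1]))
        exact mul_le_mul_of_nonneg_left (Real.exp_le_exp.2 (by linarith [hu.2])) (h0 x)
      have e2 : ∫ u in Ioi (0 : ℝ), fejerKernel (l * (u - (x + δ))) ≤
          ∫ u, fejerKernel (l * (u - (x + δ))) :=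
        setIntegral_le_integral (hKi _) (ae_of_all _ (hKn _))
      have e3 := hsmall' _ hx1
      have e4 := le_abs_self
        (∫ u in Ioi (0 : ℝ), (B u - c) * fejerKernel (l * (u - (x + δ))))
      nth_rewrite 1 [hsplit] at e4
      have e5 := hnear (x + δ)
      have e6 := htot (x + δ)
      have hBx : 0 ≤ B x * Real.exp (-(2 * δ)) := mul_nonneg (h0 x) (Real.exp_pos _).le
      refine le_of_mul_le_mul_right ?_ hTpos
      calc B x * Real.exp (-(2 * δ)) * (1 - δ) * T
          = B x * Real.exp (-(2 * δ)) * (T * (1 - δ)) := by ring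
        _ ≤ B x * Real.exp (-(2 * δ)) * (l * ∫ u in Ioc (x + δ - δ) (x + δ + δ),
              fejerKernel (l * (u - (x + δ)))) := mul_le_mul_of_nonneg_left e5 hBx
        _ ≤ l * ∫ u in Ioi (0 : ℝ), B u * fejerKernel (l * (u - (x + δ))) := by
            have := mul_le_mul_of_nonneg_left e1 hlpos.le
            linarith
        _ ≤ l * (c * (∫ u in Ioi (0 : ℝ), fejerKernel (l * (u - (x + δ)))) +
              |∫ u in Ioi (0 : ℝ), (B u - c) * fejerKernel (l * (u - (x + δ)))|) :=
            mul_le_mul_of_nonneg_left (by linarith) hlpos.le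
        _ ≤ (c + δ) * T := by
            have := mul_le_mul_of_nonneg_left e2 (mul_nonneg hlpos.le hc)
            have e7 : l * c * ∫ u, fejerKernel (l * (u - (x + δ))) = c * T := by
              rw [← e6]; ring
            linarith
    -- Lower bound: on `(x - 2 * δ, x]` the function `B` is at most `B x * exp (2 * δ)`, and the
    -- small mass of the kernel outside this interval is weighted by at most `M`.
    · have hsub : Ioc (x - δ - δ) (x - δ + δ) ⊆ Ioi 0 := fun u hu ↦ by
        have := hu.1
        simp only [mem_Ioi]
        linarith
      set N := ∫ u in Ioc (x - δ - δ) (x - δ + δ), fejerKernel (l * (u - (x - δ))) with hN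
      have e1 : ∫ u in Ioi (0 : ℝ), B u * fejerKernel (l * (u - (x - δ))) ≤
          B x * Real.exp (2 * δ) * N +
          M * ((∫ u, fejerKernel (l * (u - (x - δ)))) - N) := by
        have s1 : ∫ u in Ioi (0 : ℝ), B u * fejerKernel (l * (u - (x - δ))) ≤
            ∫ u, B u * fejerKernel (l * (u - (x - δ))) :=
          setIntegral_le_integral (hBK _) (ae_of_all _ fun u ↦ mul_nonneg (h0 u) (hKn _ u))
        have s2 := integral_add_compl (s := Ioc (x - δ - δ) (x - δ + δ)) measurableSet_Ioc
          (hBK (x - δ))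
        have s3 := integral_add_compl (s := Ioc (x - δ - δ) (x - δ + δ)) measurableSet_Ioc
          (hKi (x - δ))
        have s4 : ∫ u in Ioc (x - δ - δ) (x - δ + δ), B u * fejerKernel (l * (u - (x - δ))) ≤
            B x * Real.exp (2 * δ) * N := by
          rw [hN, ← integral_const_mul]
          refine setIntegral_mono_on (hBK _).integrableOn ((hKi _).const_mul _).integrableOn
            measurableSet_Ioc fun u hu ↦ ?_
          refine mul_le_mul_of_nonneg_right ?_ (hKn _ _)
          have h1 := hexp (u := u) (v := x) (by linarith [hu.2])
          rw [← div_le_iff₀ (Real.exp_pos _), div_eq_mul_inv, ← Real.exp_neg]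
          refine le_trans ?_ h1
          exact mul_le_mul_of_nonneg_left (Real.exp_le_exp.2 (by linarith [hu.1])) (h0 u)
        have s5 : ∫ u in (Ioc (x - δ - δ) (x - δ + δ))ᶜ, B u * fejerKernel (l * (u - (x - δ))) ≤
            M * ∫ u in (Ioc (x - δ - δ) (x - δ + δ))ᶜ, fejerKernel (l * (u - (x - δ))) := by
          rw [← integral_const_mul]
          exact setIntegral_mono (hBK _).integrableOn ((hKi _).const_mul _).integrableOn
            fun u ↦ mul_le_mul_of_nonneg_right (hM u) (hKn _ _)
        rw [← s3, add_sub_cancel_left]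
        linarith
      have e2 : N ≤ ∫ u in Ioi (0 : ℝ), fejerKernel (l * (u - (x - δ))) :=
        setIntegral_mono_set (hKi _).integrableOn (ae_of_all _ (hKn _)) hsub.eventuallyLE
      have e2' : N ≤ ∫ u, fejerKernel (l * (u - (x - δ))) :=
        setIntegral_le_integral (hKi _) (ae_of_all _ (hKn _))
      have e3 := hsmall' _ hx2
      have e4 := neg_abs_le
        (∫ u in Ioi (0 : ℝ), (B u - c) * fejerKernel (l * (u - (x - δ))))
      nth_rewrite 2 [hsplit] at e4
      have e5 := hnear (x - δ)
      rw [← hN] at e5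
      have e6 := htot (x - δ)
      have hBx : 0 ≤ B x * Real.exp (2 * δ) := mul_nonneg (h0 x) (Real.exp_pos _).le
      refine le_of_mul_le_mul_right ?_ hTpos
      have k1 := mul_le_mul_of_nonneg_left e1 hlpos.le
      have k2 := mul_le_mul_of_nonneg_left e2 (mul_nonneg hlpos.le hc)
      have k3 := mul_le_mul_of_nonneg_left e4 hlpos.le
      have k4 : B x * Real.exp (2 * δ) * (l * N) ≤ B x * Real.exp (2 * δ) * T :=
        mul_le_mul_of_nonneg_left (by
          rw [← e6]; exact mul_le_mul_of_nonneg_left e2' hlpos.le) hBx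
      have k5 : M * (T - l * N) ≤ M * (δ * T) := mul_le_mul_of_nonneg_left (by linarith) hM0
      have k6 : c * (T * (1 - δ)) ≤ c * (l * N) := mul_le_mul_of_nonneg_left e5 hc
      have k7 : l * (B x * Real.exp (2 * δ) * N +
          M * ((∫ u, fejerKernel (l * (u - (x - δ)))) - N)) =
          B x * Real.exp (2 * δ) * (l * N) + M * (T - l * N) := by
        rw [← e6]; ring
      linarith
  rw [tendsto_order]
  constructor
  · intro a ha
    have : ContinuousAt (fun δ : ℝ ↦ (c * (1 - δ) - δ - M * δ) / Real.exp (2 * δ)) 0 :=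
      (by fun_prop : Continuous _).continuousAt.div (by fun_prop) (Real.exp_pos _).ne'
    have h1 : ∀ᶠ δ in 𝓝[>] (0 : ℝ), a < (c * (1 - δ) - δ - M * δ) / Real.exp (2 * δ) :=
      (this.tendsto.eventually (lt_mem_nhds (by simpa using ha))).filter_mono nhdsWithin_le_nhds
    obtain ⟨δ, hδ, hδ0⟩ := (h1.and self_mem_nhdsWithin).exists
    filter_upwards [main δ hδ0] with x hx
    exact hδ.trans_le ((div_le_iff₀ (Real.exp_pos _)).2 hx.2)
  · intro a ha
    have : ContinuousAt (fun δ : ℝ ↦ (c + δ) / (Real.exp (-(2 * δ)) * (1 - δ))) 0 :=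
      (by fun_prop : Continuous _).continuousAt.div (by fun_prop) (by simp)
    have h1 : ∀ᶠ δ in 𝓝[>] (0 : ℝ), (c + δ) / (Real.exp (-(2 * δ)) * (1 - δ)) < a :=
      (this.tendsto.eventually (gt_mem_nhds (by simpa using ha))).filter_mono nhdsWithin_le_nhds
    obtain ⟨δ, hδ, hδ0, hδ1⟩ := (h1.and (Ioo_mem_nhdsGT zero_lt_one)).exists
    filter_upwards [main δ hδ0] with x hx
    refine lt_of_le_of_lt ((le_div_iff₀ (mul_pos (Real.exp_pos _) (by linarith))).2 ?_) hδ
    rw [← mul_assoc]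
    exact hx.1

/-- A Tauberian theorem of Wiener–Ikehara type: if `B` is bounded and `B u * exp u` is monotone and
nonnegative, and the Laplace transform of `B - c` extends continuously to the closed right
half-plane, then `B` tends to `c`. -/
theorem tendsto_of_continuousOn_laplace {B : ℝ → ℝ} {c M : ℝ}
    (hmono : Monotone fun u ↦ B u * Real.exp u) (h0 : ∀ u, 0 ≤ B u) (hM : ∀ u, B u ≤ M)
    (hc : 0 ≤ c) {g : ℂ → ℂ} (hg : ContinuousOn g {s | 0 ≤ s.re})
    (hL : ∀ s : ℂ, 0 < s.re → ∫ u in Ioi (0 : ℝ), ((B u - c : ℝ) : ℂ) * cexp (-s * u) = g s) :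
    Tendsto B atTop (𝓝 c) := by
  have hBm := measurable_of_monotone_mul_exp hmono
  refine tendsto_of_tendsto_integral_mul_fejerKernel hmono h0 hM hc fun l hl ↦ ?_
  refine tendsto_integral_mul_fejerKernel (H := fun u ↦ B u - c) (M := M + c)
    (hBm.sub_const c) (fun u ↦ ?_) hg hL hl
  rw [abs_le]
  constructor <;> linarith [h0 u, hM u, (h0 0).trans (hM 0)]

/-! ### The Chebyshev function of a residue class -/

/-- The Chebyshev function of a residue class: the sum of `Λ n` over `n ≤ x` with `n ≡ a`
modulo `q`. -/
noncomputable def psiAP {q : ℕ} (a : ZMod q) (x : ℝ) : ℝ :=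
  ∑ n ∈ Finset.Icc 1 ⌊x⌋₊, residueClass a n

lemma psiAP_nonneg {q : ℕ} (a : ZMod q) (x : ℝ) : 0 ≤ psiAP a x :=
  Finset.sum_nonneg fun n _ ↦ residueClass_nonneg a n

lemma psiAP_mono {q : ℕ} (a : ZMod q) : Monotone (psiAP a) := fun _ _ h ↦
  Finset.sum_le_sum_of_subset_of_nonneg
    (Finset.Icc_subset_Icc_right (Nat.floor_mono h)) fun n _ _ ↦ residueClass_nonneg a n

lemma psiAP_le {q : ℕ} (a : ZMod q) {x : ℝ} (hx : 0 ≤ x) :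
    psiAP a x ≤ (Real.log 4 + 4) * x := by
  refine le_trans ?_ (Chebyshev.psi_le_const_mul_self hx)
  exact Finset.sum_le_sum fun n _ ↦ residueClass_le a n

lemma LSeries_residueClass_eq_mul_integral {q : ℕ} (a : ZMod q) {s : ℂ} (hs : 1 < s.re) :
    LSeries (fun n ↦ (residueClass a n : ℂ)) s =
      s * ∫ u in Ioi (0 : ℝ), ((psiAP a (Real.exp u) * Real.exp (-u) : ℝ) : ℂ) *
        cexp (-(s - 1) * u) := by
  rw [LSeries_eq_mul_integral_of_nonneg _ zero_le_one hs ?_ (residueClass_nonneg a)]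
  · have himg : Real.exp '' Ioi 0 = Ioi 1 := by
      ext x
      constructor
      · rintro ⟨u, hu, rfl⟩
        exact Real.one_lt_exp_iff.2 hu
      · intro hx
        have hx' : (1 : ℝ) < x := hx
        exact ⟨Real.log x, Real.log_pos hx', Real.exp_log (by linarith)⟩
    rw [← himg, integral_image_eq_integral_abs_deriv_smul measurableSet_Ioi
      (fun u _ ↦ (Real.hasDerivAt_exp u).hasDerivWithinAt) Real.exp_injective.injOn]
    congr 1
    refine integral_congr_ae (ae_of_all _ fun u ↦ ?_)
    have e1 : ((Real.exp u : ℝ) : ℂ) ^ (-(s + 1)) = cexp (-(s + 1) * u) := by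
      rw [cpow_def_of_ne_zero (by exact_mod_cast (Real.exp_pos u).ne'), ← ofReal_log
        (Real.exp_pos u).le, Real.log_exp, mul_comm]
    have e2 : cexp u * cexp (-(s + 1) * u) = cexp (-u) * cexp (-(s - 1) * u) := by
      rw [← Complex.exp_add, ← Complex.exp_add]
      congr 1
      ring
    simp only [abs_of_pos (Real.exp_pos u), real_smul, e1, psiAP]
    push_cast
    linear_combination (∑ k ∈ Finset.Icc 1 ⌊Real.exp u⌋₊, (residueClass a k : ℂ)) * e2
  · simp_rw [Real.rpow_one]
    refine Asymptotics.IsBigO.of_bound (Real.log 4 + 4) (.of_forall fun n ↦ ?_)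
    have h1 := psiAP_le a (Nat.cast_nonneg n)
    have h2 := psiAP_nonneg a n
    rw [psiAP, Nat.floor_natCast] at h1 h2
    rwa [Real.norm_of_nonneg h2, Real.norm_of_nonneg (Nat.cast_nonneg n)]

theorem tendsto_psiAP_div {q : ℕ} [NeZero q] {a : ZMod q} (ha : IsUnit a) :
    Tendsto (fun x ↦ psiAP a x / x) atTop (𝓝 (q.totient : ℝ)⁻¹) := by
  set c : ℝ := (q.totient : ℝ)⁻¹ with hc
  have h0 (u : ℝ) : 0 ≤ psiAP a (Real.exp u) * Real.exp (-u) :=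
    mul_nonneg (psiAP_nonneg a _) (Real.exp_pos _).le
  have hM (u : ℝ) : psiAP a (Real.exp u) * Real.exp (-u) ≤ Real.log 4 + 4 := by
    rw [Real.exp_neg, ← div_eq_mul_inv, div_le_iff₀ (Real.exp_pos u)]
    exact psiAP_le a (Real.exp_pos u).le
  have hmono : Monotone fun u ↦ psiAP a (Real.exp u) * Real.exp (-u) * Real.exp u := by
    have : (fun u ↦ psiAP a (Real.exp u) * Real.exp (-u) * Real.exp u) =
        fun u ↦ psiAP a (Real.exp u) := by
      ext u
      rw [mul_assoc, ← Real.exp_add]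
      simp
    rw [this]
    exact (psiAP_mono a).comp Real.exp_monotone
  have key : Tendsto (fun u ↦ psiAP a (Real.exp u) * Real.exp (-u)) atTop (𝓝 c) := by
    -- Subtracting `c / (s - 1)` from `L s / s`, where `L` is the `L`-series, leaves
    -- `(F s - c) / s` with `F` the auxiliary function continuous up to the line `re s = 1`.
    refine tendsto_of_continuousOn_laplace hmono h0 hM (by positivity)
      (g := fun s ↦ (LFunctionResidueClassAux a (1 + s) - c) / (1 + s)) ?_ fun s hs ↦ ?_
    · refine ContinuousOn.div (ContinuousOn.sub ?_ continuousOn_const) (by fun_prop) ?_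
      · refine (ArithmeticFunction.vonMangoldt.continuousOn_LFunctionResidueClassAux a).comp
          (by fun_prop) fun s hs ↦ ?_
        simpa using hs
      · intro s hs h
        have h1 := congrArg re h
        have h2 : 0 ≤ s.re := hs
        simp at h1
        linarith
    · have hs0 : s ≠ 0 := fun h ↦ by simp [h] at hs
      have hs1 : 1 + s ≠ 0 := fun h ↦ by
        have := congrArg re h
        simp at this
        linarith
      have hre : 1 < (1 + s).re := by simpa using hs
      have hexp : IntegrableOn (fun u : ℝ ↦ cexp (-s * u)) (Ioi 0) :=
        integrableOn_exp_mul_complex_Ioi (by simpa using hs) 0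
      have h1 := LSeries_residueClass_eq_mul_integral a hre
      have h2 := ArithmeticFunction.vonMangoldt.eqOn_LFunctionResidueClassAux ha hre
      have h3 := integral_exp_mul_complex_Ioi (a := -s) (by simpa using hs) 0
      simp only [add_sub_cancel_left] at h1 h2
      have hBi : IntegrableOn (fun u : ℝ ↦
          ((psiAP a (Real.exp u) * Real.exp (-u) : ℝ) : ℂ) * cexp (-s * u)) (Ioi 0) := by
        refine hexp.bdd_mul (c := Real.log 4 + 4) ?_ (ae_of_all _ fun u ↦ ?_)
        · exact (measurable_ofReal.comp
            (measurable_of_monotone_mul_exp hmono)).aestronglyMeasurable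
        · rw [norm_real, Real.norm_of_nonneg (h0 u)]
          exact hM u
      simp_rw [ofReal_sub, sub_mul]
      rw [integral_sub hBi (hexp.const_mul _), integral_const_mul, h3, h2, h1, hc]
      push_cast
      simp only [mul_zero, Complex.exp_zero]
      field_simp
      ring_nf
  refine (key.comp Real.tendsto_log_atTop).congr' ?_
  filter_upwards [eventually_gt_atTop 0] with x hx
  rw [Function.comp_apply, Real.exp_neg, Real.exp_log hx, div_eq_mul_inv]

/-! ### From the Chebyshev function to counting primes -/

/-- The primes `p ≤ x` with `p ≡ r` modulo `q`. -/
noncomputable def primesAP (x : ℝ) (r q : ℕ) : Finset ℕ :=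
  (Finset.range (⌊x⌋₊ + 1)).filter (fun p : ℕ => p.Prime ∧ p ≡ r [MOD q])

lemma mem_primesAP {x : ℝ} (hx : 0 ≤ x) {r q p : ℕ} :
    p ∈ primesAP x r q ↔ (p : ℝ) ≤ x ∧ p.Prime ∧ p ≡ r [MOD q] := by
  rw [primesAP, Finset.mem_filter, Finset.mem_range, Nat.lt_succ_iff, Nat.le_floor_iff hx]

/-- The sum of `log p` over the primes `p ≤ x` with `p ≡ r` modulo `q`. -/
noncomputable def thetaAP (x : ℝ) (r q : ℕ) : ℝ := ∑ p ∈ primesAP x r q, Real.log p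

lemma thetaAP_eq (x : ℝ) (r q : ℕ) :
    thetaAP x r q = ∑ n ∈ Finset.Icc 1 ⌊x⌋₊ with n.Prime, residueClass (r : ZMod q) n := by
  have h : primesAP x r q = {n ∈ {n ∈ Finset.Icc 1 ⌊x⌋₊ | n.Prime} | n ≡ r [MOD q]} := by
    ext p
    simp only [primesAP, Finset.mem_filter, Finset.mem_range, Finset.mem_Icc, Nat.lt_succ_iff]
    exact ⟨fun h ↦ ⟨⟨⟨h.2.1.pos, h.1⟩, h.2.1⟩, h.2.2⟩, fun h ↦ ⟨h.1.1.2, h.1.2, h.2⟩⟩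
  rw [thetaAP, h, Finset.sum_filter]
  refine Finset.sum_congr rfl fun p hp ↦ ?_
  have hp' : p.Prime := (Finset.mem_filter.1 hp).2
  by_cases hpr : p ≡ r [MOD q]
  · rw [if_pos hpr, residueClass, indicator_of_mem
      (by simpa using (ZMod.natCast_eq_natCast_iff p r q).2 hpr),
      ArithmeticFunction.vonMangoldt_apply_prime hp']
  · rw [if_neg hpr, residueClass, indicator_of_notMem
      (by simpa using fun h ↦ hpr ((ZMod.natCast_eq_natCast_iff p r q).1 h))]

lemma thetaAP_le_psiAP (x : ℝ) (r q : ℕ) : thetaAP x r q ≤ psiAP (r : ZMod q) x := by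
  rw [thetaAP_eq, psiAP]
  exact Finset.sum_le_sum_of_subset_of_nonneg (Finset.filter_subset _ _)
    fun n _ _ ↦ residueClass_nonneg _ n

lemma psiAP_sub_thetaAP_le {x : ℝ} (hx : 1 ≤ x) (r q : ℕ) :
    psiAP (r : ZMod q) x - thetaAP x r q ≤ 2 * √x * Real.log x := by
  refine le_trans ?_ (Chebyshev.psi_sub_theta_le hx)
  rw [thetaAP_eq, psiAP, Chebyshev.psi_sub_theta_eq_sum_not_prime,
    ← Finset.sum_filter_add_sum_filter_not (Finset.Icc 1 ⌊x⌋₊) Nat.Prime, add_sub_cancel_left]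
  exact Finset.sum_le_sum fun n _ ↦ residueClass_le _ n

lemma tendsto_thetaAP_div {r q : ℕ} [NeZero q] (hr : r.Coprime q) :
    Tendsto (fun x ↦ thetaAP x r q / x) atTop (𝓝 (q.totient : ℝ)⁻¹) := by
  have h1 := tendsto_psiAP_div ((ZMod.isUnit_iff_coprime r q).2 hr)
  have h2 : Tendsto (fun x : ℝ ↦ 2 * (Real.log x / x ^ (1 / 2 : ℝ))) atTop (𝓝 0) := by
    have := (isLittleO_log_rpow_atTop (r := 1 / 2) (by norm_num)).tendsto_div_nhds_zero
    simpa using this.const_mul 2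
  have h3 := h1.sub h2
  rw [sub_zero] at h3
  refine tendsto_of_tendsto_of_tendsto_of_le_of_le' h3 h1 ?_ ?_
  · filter_upwards [eventually_ge_atTop 1] with x hx
    have hx0 : 0 < x := by linarith
    have := psiAP_sub_thetaAP_le hx r q
    rw [← Real.sqrt_eq_rpow, sub_le_iff_le_add, ← sub_le_iff_le_add', ← sub_div, div_le_iff₀ hx0]
    refine this.trans_eq ?_
    have hs := Real.mul_self_sqrt hx0.le
    have hs0 : √x ≠ 0 := (Real.sqrt_pos.2 hx0).ne'
    field_simp
    linear_combination Real.log x * hs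
  · filter_upwards [eventually_gt_atTop 0] with x hx
    exact div_le_div_of_nonneg_right (thetaAP_le_psiAP x r q) hx.le

lemma thetaAP_le_primeCountingAP_mul_log {x : ℝ} (hx : 0 ≤ x) (r q : ℕ) :
    thetaAP x r q ≤ primeCountingAP x r q * Real.log x := by
  rw [thetaAP, primeCountingAP, ← nsmul_eq_mul]
  refine Finset.sum_le_card_nsmul _ _ _ fun p hp ↦ ?_
  have hp' := (mem_primesAP hx).1 hp
  exact Real.log_le_log (by exact_mod_cast hp'.2.1.pos) hp'.1

/-- All but `x ^ α` of the primes counted exceed `x ^ α`, and contribute at least `α * log x`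
each. -/
lemma primeCountingAP_mul_log_le {x α : ℝ} (hx : 1 ≤ x) (hα : 0 ≤ α) (r q : ℕ) :
    α * Real.log x * (primeCountingAP x r q - x ^ α) ≤ thetaAP x r q := by
  have hx0 : 0 < x := by linarith
  have hxα : 0 < x ^ α := Real.rpow_pos_of_pos hx0 α
  have hsmall : ((primesAP x r q).filter fun p : ℕ ↦ (p : ℝ) ≤ x ^ α).card ≤ x ^ α := by
    refine le_trans ?_ (Nat.floor_le hxα.le)
    have : ((primesAP x r q).filter fun p : ℕ ↦ (p : ℝ) ≤ x ^ α) ⊆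
        Finset.Icc 1 ⌊x ^ α⌋₊ := fun p hp ↦ by
      rw [Finset.mem_filter, mem_primesAP hx0.le] at hp
      exact Finset.mem_Icc.2 ⟨hp.1.2.1.pos, Nat.le_floor hp.2⟩
    have := Finset.card_le_card this
    rw [Nat.card_Icc, Nat.add_sub_cancel] at this
    exact_mod_cast this
  have hcard : (primeCountingAP x r q : ℝ) =
      ((primesAP x r q).filter fun p : ℕ ↦ (p : ℝ) ≤ x ^ α).card +
      ((primesAP x r q).filter fun p : ℕ ↦ ¬ (p : ℝ) ≤ x ^ α).card := by
    rw [← Nat.cast_add, Finset.card_filter_add_card_filter_not]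
    rfl
  have hlog : 0 ≤ α * Real.log x := mul_nonneg hα (Real.log_nonneg hx)
  calc α * Real.log x * (primeCountingAP x r q - x ^ α)
      ≤ α * Real.log x * ((primesAP x r q).filter fun p : ℕ ↦ ¬ (p : ℝ) ≤ x ^ α).card :=
        mul_le_mul_of_nonneg_left (by linarith) hlog
    _ ≤ ∑ p ∈ (primesAP x r q).filter fun p : ℕ ↦ ¬ (p : ℝ) ≤ x ^ α, Real.log p := by
        rw [mul_comm, ← nsmul_eq_mul]
        refine Finset.card_nsmul_le_sum _ _ _ fun p hp ↦ ?_
        rw [← Real.log_rpow hx0]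
        exact Real.log_le_log hxα (not_le.1 (Finset.mem_filter.1 hp).2).le
    _ ≤ thetaAP x r q :=
        Finset.sum_le_sum_of_subset_of_nonneg (Finset.filter_subset _ _)
          fun p _ _ ↦ Real.log_natCast_nonneg p

/-- The **prime number theorem for arithmetic progressions**. -/
theorem tendsto_primeCountingAP {r q : ℕ} [NeZero q] (hr : r.Coprime q) :
    Tendsto (fun x : ℝ ↦ (primeCountingAP x r q : ℝ) * q.totient / (x / Real.log x))
      atTop (𝓝 1) := by
  have hφ : (0 : ℝ) < q.totient := by exact_mod_cast Nat.totient_pos.2 (NeZero.pos q)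
  set c : ℝ := (q.totient : ℝ)⁻¹ with hc
  have hθ := tendsto_thetaAP_div hr
  have key : Tendsto (fun x : ℝ ↦ primeCountingAP x r q * Real.log x / x) atTop (𝓝 c) := by
    rw [tendsto_order]
    constructor
    · intro b hb
      filter_upwards [hθ.eventually (lt_mem_nhds hb), eventually_gt_atTop 0] with x h1 hx
      exact h1.trans_le
        (div_le_div_of_nonneg_right (thetaAP_le_primeCountingAP_mul_log hx.le r q) hx.le)
    · intro b hb
      obtain ⟨α, hα, hα0, hα1⟩ : ∃ α : ℝ, c / α < b ∧ 0 < α ∧ α < 1 := by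
        have : ContinuousAt (fun α : ℝ ↦ c / α) 1 :=
          continuousAt_const.div continuousAt_id one_ne_zero
        have h1 : ∀ᶠ α in 𝓝[<] (1 : ℝ), c / α < b :=
          (this.tendsto.eventually (gt_mem_nhds (by simpa using hb))).filter_mono
            nhdsWithin_le_nhds
        exact (h1.and (Ioo_mem_nhdsLT zero_lt_one)).exists
      have h1 : Tendsto (fun x : ℝ ↦ thetaAP x r q / x / α + Real.log x / x ^ (1 - α)) atTop
          (𝓝 (c / α + 0)) :=
        (hθ.div_const α).add (isLittleO_log_rpow_atTop (by linarith)).tendsto_div_nhds_zero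
      rw [add_zero] at h1
      filter_upwards [h1.eventually (gt_mem_nhds hα), eventually_ge_atTop 1] with x h2 hx
      refine lt_of_le_of_lt ?_ h2
      have hx0 : 0 < x := by linarith
      have h3 := primeCountingAP_mul_log_le hx hα0.le r q
      rw [Real.rpow_sub hx0, Real.rpow_one, div_le_iff₀ hx0]
      have hxα : x ^ α ≠ 0 := (Real.rpow_pos_of_pos hx0 α).ne'
      have h4 : (thetaAP x r q / x / α + Real.log x / (x / x ^ α)) * x =
          thetaAP x r q / α + Real.log x * x ^ α := by
        field_simp
      rw [h4, ← sub_le_iff_le_add, le_div_iff₀ hα0]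
      linarith
  have h := key.mul_const (q.totient : ℝ)
  rw [hc, inv_mul_cancel₀ hφ.ne'] at h
  refine h.congr fun x ↦ ?_
  rw [div_div_eq_mul_div]
  ring

end PrimesInArithmeticProgressions

theorem mainTheorem7 (r : ℕ) (hr : Nat.Coprime r 360) :
    Filter.Tendsto
      (fun x : ℝ => ((primeCountingAP x r 360 : ℝ) * (Nat.totient 360 : ℝ)) / (x / Real.log x))
      Filter.atTop (nhds 1) := by
  exact tendsto_primeCountingAP hr
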